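/- There is a function $c:\mathbb{R}\to\mathbb{R}$, bounded away from $0$ when $\delta$ is (for every $\delta_0>0$ there is $\kappa>0$ with $c(\delta)\ge\kappa$ for all $\delta\in[\delta_0,1/2)$), such that the following holds. Let $0<\delta<1/2$, let $\mathcal{C}\subseteq\mathbb{F}_2^n$ be a binary linear code, let $0\le\epsilon\le 1$, and let $i\ne j$ be coordinates in $[n]$. Let $X$ be uniformly distributed on $\mathcal{C}$ and let $Y^\epsilon\in\{0,1,?\}^n$ be the result of passing $X$ through the binary erasure channel BEC($\epsilon$). Write $Y^\epsilon_{\sim i}$ for $Y^\epsilon$ without coordinate $i$, and $Y^\epsilon_{\sim i,j}$ for $Y^\epsilon$ without coordinates $i$ and $j$; information is measured in bits. For $z\in\{0,1\}^n$ and $(a,b)\in\{0,1\}^2$ say that $z$ covers the type $(a,b)$ if there is $x\in\mathcal{C}$ with $(x_i,x_j)=(a,b)$ and $\mathrm{supp}(x)\subseteq\mathrm{supp}(z)$. Let $\mathcal{B}_2,\mathcal{B}_3,\mathcal{B}_4$ be the sets of those $z$ that cover exactly one of the three nonzero types $(0,1),(1,0),(1,1)$, this one being $(0,1)$, $(1,0)$,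 $(1,1)$, respectively. Let $Z^\epsilon\in\{0,1\}^n$ be random with $Z^\epsilon_i=Z^\epsilon_j=1$ and with the other coordinates i.i.d. Bernoulli($\epsilon$). If $I(X_i;Y^\epsilon_{\sim i})\in(\delta,1-\delta)$, then $\Pr(Z^\epsilon\in\mathcal{B}_2\cup\mathcal{B}_3\cup\mathcal{B}_4)>0$, and $$I(X_i;X_j\mid Y^\epsilon_{\sim i,j})\ \ge\ \frac{c(\delta)}{\sqrt n}\,\alpha_{ij}^\epsilon,\qquad \alpha_{ij}^\epsilon:=\Pr\left(Z^\epsilon\in\mathcal{B}_4\mid Z^\epsilon\in\mathcal{B}_2\cup\mathcal{B}_3\cup\mathcal{B}_4\right).$$ -/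

import Mathlib

/-! ### Finite probability and Shannon information (in bits)

A probability law on a finite type `Ω` is given by its mass function `p : Ω → ℝ`. -/

section Information

variable {Ω α β γ : Type*} [Fintype Ω] [Fintype α] [Fintype β] [Fintype γ]

open Classical in
/-- The probability of the event `E` under the law `p`. -/
noncomputable def prob (p : Ω → ℝ) (E : Set Ω) : ℝ :=
  ∑ ω, if ω ∈ E then p ω else 0

/-- The conditional probability of `E` given `F`. -/
noncomputable def condProb (p : Ω → ℝ) (E F : Set Ω) : ℝ :=
  prob p (E ∩ F) / prob p F

/-- The Shannon entropy `H(X)` in bits. -/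
noncomputable def entropy (p : Ω → ℝ) (X : Ω → α) : ℝ :=
  ∑ a, -(prob p {ω | X ω = a} * Real.logb 2 (prob p {ω | X ω = a}))

/-- The entropy `H(X | F)` in bits of the conditional law of `X` given the event `F`. -/
noncomputable def entropyGiven (p : Ω → ℝ) (X : Ω → α) (F : Set Ω) : ℝ :=
  ∑ a, -(condProb p {ω | X ω = a} F * Real.logb 2 (condProb p {ω | X ω = a} F))

/-- The conditional entropy `H(X | W) = ∑ w, P(W = w) H(X | W = w)` in bits. -/
noncomputable def condEntropy (p : Ω → ℝ) (X : Ω → α) (W : Ω → γ) : ℝ :=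
  ∑ w, prob p {ω | W ω = w} * entropyGiven p X {ω | W ω = w}

/-- The mutual information `I(X; Y) = H(X) - H(X | Y)` in bits. -/
noncomputable def mutualInfo (p : Ω → ℝ) (X : Ω → α) (Y : Ω → β) : ℝ :=
  entropy p X - condEntropy p X Y

/-- The conditional mutual information `I(X; Y | W) = H(X | W) - H(X | Y, W)` in bits. -/
noncomputable def condMutualInfo (p : Ω → ℝ) (X : Ω → α) (Y : Ω → β) (W : Ω → γ) : ℝ :=
  condEntropy p X W - condEntropy p X (fun ω => (Y ω, W ω))

end Information

/-! ### A binary linear code on the binary erasure channel -/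

section Channel

variable {n : ℕ}

/-- Transition probabilities `P(y | x)` of the BEC(`ε`); the output `none` is the erasure symbol. -/
noncomputable def becTransition (ε : ℝ) (x : ZMod 2) : Option (ZMod 2) → ℝ
  | none => ε
  | some b => if b = x then 1 - ε else 0

open Classical in
/-- The joint law of `(X, Y)`: `X` is uniform on the code `C`, and `Y` is the output of `n`
independent uses of the BEC(`ε`) with input `X`. -/
noncomputable def becLaw (C : Submodule (ZMod 2) (Fin n → ZMod 2)) (ε : ℝ)
    (ω : (Fin n → ZMod 2) × (Fin n → Option (ZMod 2))) : ℝ :=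
  (if ω.1 ∈ C then (Nat.card C : ℝ)⁻¹ else 0) * ∏ k, becTransition ε (ω.1 k) (ω.2 k)

/-- The random variable `X_i`. -/
def bitX (i : Fin n) (ω : (Fin n → ZMod 2) × (Fin n → Option (ZMod 2))) : ZMod 2 :=
  ω.1 i

/-- The random vector `Y_{∼i}`: all channel outputs except the one at `i`. -/
def outExcept (i : Fin n) (ω : (Fin n → ZMod 2) × (Fin n → Option (ZMod 2))) :
    {k : Fin n // k ≠ i} → Option (ZMod 2) :=
  fun k => ω.2 k

/-- The random vector `Y_{∼i,j}`: all channel outputs except those at `i` and `j`. -/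
def outExceptTwo (i j : Fin n) (ω : (Fin n → ZMod 2) × (Fin n → Option (ZMod 2))) :
    {k : Fin n // k ≠ i ∧ k ≠ j} → Option (ZMod 2) :=
  fun k => ω.2 k

end Channel

/-! ### Covered codewords and the erasure pattern -/

section Patterns

variable {n : ℕ}

/-- The codewords `c` of `C` with `(c_i, c_j) = (a, b)`. -/
def typeCode (C : Submodule (ZMod 2) (Fin n → ZMod 2)) (i j : Fin n) (a b : ZMod 2) :
    Set (Fin n → ZMod 2) :=
  {c | c ∈ C ∧ c i = a ∧ c j = b}

/-- The elements of `A` that are covered by `z`: the support of `z` contains theirs. -/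
def coveredBy (A : Set (Fin n → ZMod 2)) (z : Fin n → ZMod 2) : Set (Fin n → ZMod 2) :=
  {a | a ∈ A ∧ ∀ k, a k = 1 → z k = 1}

/-- The patterns that cover a codeword of type `(0, 1)` and none of types `(1, 0)`, `(1, 1)`. -/
def only01 (C : Submodule (ZMod 2) (Fin n → ZMod 2)) (i j : Fin n) : Set (Fin n → ZMod 2) :=
  {z | (coveredBy (typeCode C i j 0 1) z).Nonempty ∧
    coveredBy (typeCode C i j 1 0) z = ∅ ∧ coveredBy (typeCode C i j 1 1) z = ∅}

/-- The patterns that cover a codeword of type `(1, 0)` and none of types `(0, 1)`, `(1, 1)`. -/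
def only10 (C : Submodule (ZMod 2) (Fin n → ZMod 2)) (i j : Fin n) : Set (Fin n → ZMod 2) :=
  {z | (coveredBy (typeCode C i j 1 0) z).Nonempty ∧
    coveredBy (typeCode C i j 0 1) z = ∅ ∧ coveredBy (typeCode C i j 1 1) z = ∅}

/-- The patterns that cover a codeword of type `(1, 1)` and none of types `(0, 1)`, `(1, 0)`. -/
def only11 (C : Submodule (ZMod 2) (Fin n → ZMod 2)) (i j : Fin n) : Set (Fin n → ZMod 2) :=
  {z | (coveredBy (typeCode C i j 1 1) z).Nonempty ∧
    coveredBy (typeCode C i j 0 1) z = ∅ ∧ coveredBy (typeCode C i j 1 0) z = ∅}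

/-- The law of the erasure pattern `Z` in which `i` and `j` are erased and every other
coordinate is erased independently with probability `ε` (`1` means erased). -/
noncomputable def patternLaw (ε : ℝ) (i j : Fin n) (z : Fin n → ZMod 2) : ℝ :=
  ∏ k, if k = i ∨ k = j then (if z k = 1 then 1 else 0) else (if z k = 1 then ε else 1 - ε)

/-- The quantity `α_{ij}^ε`: the conditional probability that `Z` covers, among the nonzero types
`(0, 1)`, `(1, 0)`, `(1, 1)`, only `(1, 1)`, given that it covers exactly one of them. -/
noncomputable def alphaCoeff (C : Submodule (ZMod 2) (Fin n → ZMod 2)) (ε : ℝ) (i j : Fin n) : ℝ :=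
  condProb (patternLaw ε i j) (only11 C i j) (only01 C i j ∪ only10 C i j ∪ only11 C i j)

end Patterns

/-!
On the erasure channel, `X_i` is either determined by an observation or uniform given it: the
latter happens exactly when a codeword with a one at `i` is invisible to the observation, because
adding that codeword preserves the joint law. Hence every conditional entropy of `X_i` is a
probability. In particular `I(X_i; X_j | Y_{∼i,j}) = P(Z ∈ B₄)`, and `H(X_i | Y_{∼i})` lies between
the probabilities that `Z` covers type `(1, 0)` and that it covers type `(1, 0)` or `(1, 1)`.

Let `A` be the increasing event that `Z` covers some nonzero type. If `z ∈ A` covers two types, it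
covers codewords of all three, and a coordinate cannot be a one in two codewords and in their sum;
so no single coordinate is pivotal, and the inner boundary of `A` lies in `B₂ ∪ B₃ ∪ B₄`. A
Margulis–Talagrand inequality gives this boundary probability at least `P(A) (1 - P(A)) / (2 √n)`.
Finally `A` is covered by `B₂ ∪ B₃ ∪ B₄` and the event that `(1, 0)` is covered, so that
`P(A)` is bounded away from `0` and `1` unless `B₂ ∪ B₃ ∪ B₄` is already likely.
-/

section Prob

variable {Ω Ω' γ : Type*} [Fintype Ω] [Fintype Ω'] [Fintype γ] {p : Ω → ℝ} {E F : Set Ω}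

theorem prob_eq_sum_indicator (p : Ω → ℝ) (E : Set Ω) : prob p E = ∑ ω, E.indicator p ω := by
  simp only [prob, Set.indicator]

theorem prob_eq_sum_mul_indicator (p : Ω → ℝ) (E : Set Ω) :
    prob p E = ∑ ω, p ω * E.indicator 1 ω := by
  simp only [prob_eq_sum_indicator, ← Set.indicator_mul_right, Pi.one_apply, mul_one]

theorem prob_empty (p : Ω → ℝ) : prob p ∅ = 0 := by
  simp [prob_eq_sum_indicator]

theorem prob_univ (p : Ω → ℝ) : prob p Set.univ = ∑ ω, p ω := by
  simp [prob_eq_sum_indicator]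

theorem prob_nonneg (hp : 0 ≤ p) (E : Set Ω) : 0 ≤ prob p E := by
  rw [prob_eq_sum_indicator]
  exact Finset.sum_nonneg fun ω _ => Set.indicator_nonneg (fun ω _ => hp ω) ω

theorem prob_mono (hp : 0 ≤ p) (h : E ⊆ F) : prob p E ≤ prob p F := by
  simp only [prob_eq_sum_indicator]
  exact Finset.sum_le_sum fun ω _ => Set.indicator_le_indicator_of_subset h hp ω

theorem prob_union_le (hp : 0 ≤ p) (E F : Set Ω) : prob p (E ∪ F) ≤ prob p E + prob p F := by
  have h : prob p (E ∪ F) + prob p (E ∩ F) = prob p E + prob p F := by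
    simp only [prob_eq_sum_indicator, ← Finset.sum_add_distrib, Set.indicator_union_add_inter_apply]
  linarith [prob_nonneg hp (E ∩ F)]

theorem prob_sdiff (p : Ω → ℝ) (h : E ⊆ F) : prob p (F \ E) = prob p F - prob p E := by
  simp only [prob_eq_sum_indicator, Set.indicator_sdiff h, Pi.sub_apply, Finset.sum_sub_distrib]

theorem exists_ne_zero_of_prob_ne_zero (h : prob p E ≠ 0) : ∃ ω ∈ E, p ω ≠ 0 := by
  rw [prob_eq_sum_indicator] at h
  obtain ⟨ω, -, hω⟩ := Finset.exists_ne_zero_of_sum_ne_zero h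
  exact ⟨ω, Set.mem_of_indicator_ne_zero hω, by rwa [Set.indicator_of_mem
    (Set.mem_of_indicator_ne_zero hω)] at hω⟩

theorem prob_preimage (p : Ω → ℝ) (W : Ω → γ) (S : Set γ) :
    prob p (W ⁻¹' S) = prob (fun w => prob p {ω | W ω = w}) S := by
  classical
  simp only [prob_eq_sum_mul_indicator _ S, prob_eq_sum_indicator, Finset.sum_mul]
  rw [Finset.sum_comm]
  refine Finset.sum_congr rfl fun ω _ => ?_
  rw [Finset.sum_eq_single (W ω)] <;> simp +contextual [Set.indicator_apply, eq_comm]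

theorem prob_preimage_of_bijective {f : Ω → Ω'} (hf : f.Bijective) (q : Ω' → ℝ) (E : Set Ω') :
    prob (q ∘ f) (f ⁻¹' E) = prob q E := by
  simp only [prob_eq_sum_indicator, ← hf.sum_comp (E.indicator q)]
  rfl

end Prob

section BitEntropy

variable {Ω γ : Type*} [Fintype Ω] [Fintype γ] {p : Ω → ℝ} {X : Ω → ZMod 2} {F : Set Ω}

theorem zmod_two_eq_zero_or_one (b : ZMod 2) : b = 0 ∨ b = 1 := by
  revert b
  decide

theorem sum_zmod_two {M : Type*} [AddCommMonoid M] (f : ZMod 2 → M) : ∑ b, f b = f 0 + f 1 :=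
  Fin.sum_univ_two f

theorem prob_eq_zero_inter_add_prob_eq_one_inter (p : Ω → ℝ) (X : Ω → ZMod 2) (F : Set Ω) :
    prob p ({ω | X ω = 0} ∩ F) + prob p ({ω | X ω = 1} ∩ F) = prob p F := by
  have h : {ω | X ω = 1} ∩ F = F \ ({ω | X ω = 0} ∩ F) := by
    ext ω
    rcases zmod_two_eq_zero_or_one (X ω) with hX | hX <;> simp [hX]
  rw [h, prob_sdiff p Set.inter_subset_right, add_sub_cancel]

theorem entropyGiven_eq_one_of_fair (hF : prob p F ≠ 0)
    (h : prob p ({ω | X ω = 0} ∩ F) = prob p ({ω | X ω = 1} ∩ F)) :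
    entropyGiven p X F = 1 := by
  have hsum := prob_eq_zero_inter_add_prob_eq_one_inter p X F
  have h0 : condProb p {ω | X ω = 0} F = 2⁻¹ := by
    rw [condProb, div_eq_iff hF]
    linarith
  have h1 : condProb p {ω | X ω = 1} F = 2⁻¹ := by
    rw [condProb, ← h]
    exact h0
  rw [entropyGiven, sum_zmod_two, h0, h1, Real.logb_inv, Real.logb_self_eq_one one_lt_two]
  norm_num

theorem entropyGiven_eq_zero_of_deterministic (hF : prob p F ≠ 0)
    (h : ∃ b, prob p ({ω | X ω = b} ∩ F) = 0) : entropyGiven p X F = 0 := by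
  have hsum := prob_eq_zero_inter_add_prob_eq_one_inter p X F
  simp only [entropyGiven, condProb, sum_zmod_two]
  obtain ⟨b, hb⟩ := h
  rcases zmod_two_eq_zero_or_one b with rfl | rfl
  · rw [hb, zero_add] at hsum
    simp [hb, hsum, hF]
  · rw [hb, add_zero] at hsum
    simp [hb, hsum, hF]

theorem condEntropy_eq_prob_of_fair_or_deterministic {W : Ω → γ} {S : Set γ}
    (hfair : ∀ w ∈ S,
      prob p ({ω | X ω = 0} ∩ {ω | W ω = w}) = prob p ({ω | X ω = 1} ∩ {ω | W ω = w}))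
    (hdet : ∀ w ∉ S, ∃ b, prob p ({ω | X ω = b} ∩ {ω | W ω = w}) = 0) :
    condEntropy p X W = prob p (W ⁻¹' S) := by
  rw [prob_preimage, prob_eq_sum_mul_indicator, condEntropy]
  refine Finset.sum_congr rfl fun w _ => ?_
  by_cases h0 : prob p {ω | W ω = w} = 0
  · rw [h0, zero_mul, zero_mul]
  by_cases hw : w ∈ S
  · rw [entropyGiven_eq_one_of_fair h0 (hfair w hw), Set.indicator_of_mem hw, Pi.one_apply]
  · rw [entropyGiven_eq_zero_of_deterministic h0 (hdet w hw), Set.indicator_of_notMem hw]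

theorem condEntropy_const {α : Type*} [Fintype α] (hp : ∑ ω, p ω = 1) (Y : Ω → α) :
    condEntropy p Y (fun _ => ()) = entropy p Y := by
  simp [condEntropy, entropy, entropyGiven, condProb, prob_univ, hp]

end BitEntropy

section Isoperimetry

variable {n : ℕ}

/-- The law of independent bits, the `k`-th of which is `1` with probability `p k`. -/
noncomputable def prodLaw (p : Fin n → ℝ) (z : Fin n → ZMod 2) : ℝ :=
  ∏ k, if z k = 1 then p k else 1 - p k

/-- Increasing events of the cube; stated through supports, since `ZMod 2` carries no order. -/
def IsIncreasing (A : Set (Fin n → ZMod 2)) : Prop :=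
  ∀ z ∈ A, ∀ z', (∀ k, z k = 1 → z' k = 1) → z' ∈ A

open Classical in
/-- The number of pivotal coordinates of a point of `A`, that is of those which cannot be set to
zero without leaving `A`; it is `0` outside `A`. -/
noncomputable def pivotCount (A : Set (Fin n → ZMod 2)) (z : Fin n → ZMod 2) : ℕ :=
  Finset.card {k | z ∈ A ∧ Function.update z k 0 ∉ A}

/-- The inner vertex boundary of an increasing event. -/
def innerBoundary (A : Set (Fin n → ZMod 2)) : Set (Fin n → ZMod 2) :=
  {z | z ∈ A ∧ ∃ k, Function.update z k 0 ∉ A}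

/-- The section of `A` at which the first coordinate equals `b`. -/
def slice (A : Set (Fin (n + 1) → ZMod 2)) (b : ZMod 2) : Set (Fin n → ZMod 2) :=
  {z | Fin.cons b z ∈ A}

theorem prodLaw_nonneg {p : Fin n → ℝ} (hp : ∀ k, p k ∈ Set.Icc 0 1) : 0 ≤ prodLaw p :=
  fun z => Finset.prod_nonneg fun k _ => by
    split_ifs
    exacts [(hp k).1, sub_nonneg.2 (hp k).2]

theorem prodLaw_cons (p : Fin (n + 1) → ℝ) (b : ZMod 2) (z : Fin n → ZMod 2) :
    prodLaw p (Fin.cons b z) = (if b = 1 then p 0 else 1 - p 0) * prodLaw (Fin.tail p) z := by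
  simp [prodLaw, Fin.prod_univ_succ, Fin.tail]

theorem sum_prodLaw_mul_succ (p : Fin (n + 1) → ℝ) (f : (Fin (n + 1) → ZMod 2) → ℝ) :
    ∑ z, prodLaw p z * f z =
      (1 - p 0) * ∑ z, prodLaw (Fin.tail p) z * f (Fin.cons 0 z) +
        p 0 * ∑ z, prodLaw (Fin.tail p) z * f (Fin.cons 1 z) := by
  rw [← (Fin.consEquiv fun _ => ZMod 2).sum_comp, Fintype.sum_prod_type, sum_zmod_two]
  simp [Fin.consEquiv, prodLaw_cons, Finset.mul_sum, mul_assoc]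

theorem sum_prodLaw (p : Fin n → ℝ) : ∑ z, prodLaw p z = 1 := by
  induction n with
  | zero => simp [prodLaw]
  | succ n ih => simpa [ih] using sum_prodLaw_mul_succ p 1

theorem prob_prodLaw_le_one {p : Fin n → ℝ} (hp : ∀ k, p k ∈ Set.Icc 0 1)
    (A : Set (Fin n → ZMod 2)) : prob (prodLaw p) A ≤ 1 := by
  rw [← sum_prodLaw p, ← prob_univ]
  exact prob_mono (prodLaw_nonneg hp) (Set.subset_univ A)

theorem prob_prodLaw_succ (p : Fin (n + 1) → ℝ) (A : Set (Fin (n + 1) → ZMod 2)) :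
    prob (prodLaw p) A = (1 - p 0) * prob (prodLaw (Fin.tail p)) (slice A 0) +
      p 0 * prob (prodLaw (Fin.tail p)) (slice A 1) := by
  simp only [prob_eq_sum_mul_indicator, sum_prodLaw_mul_succ]
  rfl

theorem IsIncreasing.union {A B : Set (Fin n → ZMod 2)} (hA : IsIncreasing A)
    (hB : IsIncreasing B) : IsIncreasing (A ∪ B) :=
  fun z hz z' h => hz.imp (hA z · z' h) (hB z · z' h)

theorem IsIncreasing.slice {A : Set (Fin (n + 1) → ZMod 2)} (hA : IsIncreasing A) (b : ZMod 2) :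
    IsIncreasing (slice A b) :=
  fun _ hz _ h => hA _ hz _ (Fin.cases (by simp) (by simpa using h))

theorem IsIncreasing.slice_zero_subset_slice_one {A : Set (Fin (n + 1) → ZMod 2)}
    (hA : IsIncreasing A) : _root_.slice A 0 ⊆ _root_.slice A 1 :=
  fun _ hz => hA _ hz _ (Fin.cases (by simp) (by simp))

theorem pivotCount_cons_zero (A : Set (Fin (n + 1) → ZMod 2)) (z : Fin n → ZMod 2) :
    pivotCount A (Fin.cons 0 z) = pivotCount (slice A 0) z := by
  classical
  simp only [pivotCount, slice, Fin.card_filter_univ_succ, Fin.update_cons_zero, Fin.cons_update,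
    Set.mem_ofPred_eq, and_not_self, if_false]

open Classical in
theorem pivotCount_cons_one (A : Set (Fin (n + 1) → ZMod 2)) (z : Fin n → ZMod 2) :
    pivotCount A (Fin.cons 1 z) =
      pivotCount (slice A 1) z + if z ∈ slice A 1 \ slice A 0 then 1 else 0 := by
  simp only [pivotCount, slice, Fin.card_filter_univ_succ, Fin.update_cons_zero, Fin.cons_update,
    Set.mem_sdiff, Set.mem_ofPred_eq]
  split_ifs <;> rfl

theorem pivotCount_le (A : Set (Fin n → ZMod 2)) (z : Fin n → ZMod 2) : pivotCount A z ≤ n :=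
  (Finset.card_le_univ _).trans_eq (Fintype.card_fin n)

theorem pivotCount_eq_zero_of_notMem_innerBoundary {A : Set (Fin n → ZMod 2)}
    {z : Fin n → ZMod 2} (hz : z ∉ innerBoundary A) : pivotCount A z = 0 := by
  classical
  rw [pivotCount, Finset.card_eq_zero, Finset.filter_eq_empty_iff]
  exact fun k _ hk => hz ⟨hk.1, k, hk.2⟩

theorem sqrt_sq_sum_add_sq_sum_le {ι : Type*} [Fintype ι] {w : ι → ℝ} (hw : 0 ≤ w)
    (u v : ι → ℝ) :
    √((∑ x, w x * u x) ^ 2 + (∑ x, w x * v x) ^ 2) ≤ ∑ x, w x * √(u x ^ 2 + v x ^ 2) := by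
  have h := norm_sum_le Finset.univ fun x => (w x : ℂ) * (⟨u x, v x⟩ : ℂ)
  have hsum : ∑ x, (w x : ℂ) * (⟨u x, v x⟩ : ℂ) = ⟨∑ x, w x * u x, ∑ x, w x * v x⟩ := by
    apply Complex.ext <;> simp
  simpa [hsum, Complex.norm_eq_sqrt_sq_add_sq, abs_of_nonneg (hw _)] using h

theorem sqrt_sq_add_sq_le_sum_sqrt_pivotCount_cons_one {q : Fin n → ℝ}
    (hq : ∀ k, q k ∈ Set.Icc 0 1) {A : Set (Fin (n + 1) → ZMod 2)} (hA : IsIncreasing A) :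
    √((∑ z, prodLaw q z * √(pivotCount (slice A 1) z)) ^ 2 +
        (prob (prodLaw q) (slice A 1) - prob (prodLaw q) (slice A 0)) ^ 2) ≤
      ∑ z, prodLaw q z * √(pivotCount A (Fin.cons 1 z)) := by
  rw [← prob_sdiff _ hA.slice_zero_subset_slice_one, prob_eq_sum_mul_indicator]
  refine (sqrt_sq_sum_add_sq_sum_le (prodLaw_nonneg hq) _ _).trans_eq
    (Finset.sum_congr rfl fun z _ => ?_)
  rw [pivotCount_cons_one, Real.sq_sqrt (Nat.cast_nonneg _)]
  by_cases hz : z ∈ slice A 1 \ slice A 0 <;> simp [hz]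

theorem two_point_isoperimetry {p a b s : ℝ} (hp : 0 ≤ p) (ha : 0 ≤ a) (hab : a ≤ b) (hb : b ≤ 1)
    (hs : 1 / 2 * (b * (1 - b)) ≤ s) :
    1 / 2 * (((1 - p) * a + p * b) * (1 - ((1 - p) * a + p * b))) ≤
      (1 - p) * (1 / 2 * (a * (1 - a))) + p * √(s ^ 2 + (b - a) ^ 2) := by
  set J := 1 / 2 * (b * (1 - b)) with hJ
  have hJ0 : 0 ≤ J := by nlinarith
  have hJ1 : J ≤ 1 / 8 := by nlinarith [sq_nonneg (b - 1 / 2)]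
  have hd1 : (b - a) ^ 2 ≤ 1 := by nlinarith
  have hgain : J + (b - a) ^ 2 / 2 ≤ √(s ^ 2 + (b - a) ^ 2) := by
    apply Real.le_sqrt_of_sq_le
    calc (J + (b - a) ^ 2 / 2) ^ 2 = J ^ 2 + (b - a) ^ 2 * (J + (b - a) ^ 2 / 4) := by ring
      _ ≤ s ^ 2 + (b - a) ^ 2 * 1 := by gcongr; linarith
      _ = s ^ 2 + (b - a) ^ 2 := by rw [mul_one]
  calc 1 / 2 * (((1 - p) * a + p * b) * (1 - ((1 - p) * a + p * b)))
      = (1 - p) * (1 / 2 * (a * (1 - a))) + p * (J + (b - a) ^ 2 / 2) -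
          p ^ 2 * (b - a) ^ 2 / 2 := by rw [hJ]; ring
    _ ≤ (1 - p) * (1 / 2 * (a * (1 - a))) + p * (J + (b - a) ^ 2 / 2) :=
        sub_le_self _ (by positivity)
    _ ≤ (1 - p) * (1 / 2 * (a * (1 - a))) + p * √(s ^ 2 + (b - a) ^ 2) := by gcongr

theorem half_mul_one_sub_le_sum_sqrt_pivotCount {p : Fin n → ℝ} (hp : ∀ k, p k ∈ Set.Icc 0 1)
    {A : Set (Fin n → ZMod 2)} (hA : IsIncreasing A) :
    1 / 2 * (prob (prodLaw p) A * (1 - prob (prodLaw p) A)) ≤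
      ∑ z, prodLaw p z * √(pivotCount A z) := by
  induction n with
  | zero =>
    have hrhs : 0 ≤ ∑ z, prodLaw p z * √(pivotCount A z) :=
      Finset.sum_nonneg fun z _ => mul_nonneg (prodLaw_nonneg hp z) (Real.sqrt_nonneg _)
    rcases A.eq_empty_or_nonempty with rfl | hne
    · simpa [prob_empty] using hrhs
    · rw [Subsingleton.eq_univ_of_nonempty hne] at hrhs ⊢
      rwa [prob_univ, sum_prodLaw, sub_self, mul_zero, mul_zero]
  | succ n ih =>
    have hq : ∀ k, Fin.tail p k ∈ Set.Icc 0 1 := fun k => hp k.succ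
    have hstep := two_point_isoperimetry (hp 0).1 (prob_nonneg (prodLaw_nonneg hq) (slice A 0))
      (prob_mono (prodLaw_nonneg hq) hA.slice_zero_subset_slice_one)
      (prob_prodLaw_le_one hq (slice A 1)) (ih hq (hA.slice 1))
    rw [prob_prodLaw_succ, sum_prodLaw_mul_succ]
    simp only [pivotCount_cons_zero]
    exact hstep.trans <| add_le_add
      (mul_le_mul_of_nonneg_left (ih hq (hA.slice 0)) (sub_nonneg.2 (hp 0).2))
      (mul_le_mul_of_nonneg_left (sqrt_sq_add_sq_le_sum_sqrt_pivotCount_cons_one hq hA) (hp 0).1)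

theorem half_mul_one_sub_le_sqrt_mul_prob_innerBoundary {p : Fin n → ℝ}
    (hp : ∀ k, p k ∈ Set.Icc 0 1) {A : Set (Fin n → ZMod 2)} (hA : IsIncreasing A) :
    1 / 2 * (prob (prodLaw p) A * (1 - prob (prodLaw p) A)) ≤
      √n * prob (prodLaw p) (innerBoundary A) := by
  refine (half_mul_one_sub_le_sum_sqrt_pivotCount hp hA).trans ?_
  rw [prob_eq_sum_mul_indicator, Finset.mul_sum]
  refine Finset.sum_le_sum fun z _ => ?_
  rw [mul_left_comm]
  refine mul_le_mul_of_nonneg_left ?_ (prodLaw_nonneg hp z)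
  by_cases hz : z ∈ innerBoundary A
  · simpa [hz] using Real.sqrt_le_sqrt (Nat.cast_le.2 (pivotCount_le A z))
  · simp [hz, pivotCount_eq_zero_of_notMem_innerBoundary hz]

end Isoperimetry

section Covering

variable {n : ℕ} {C : Submodule (ZMod 2) (Fin n → ZMod 2)} {i j : Fin n} {z : Fin n → ZMod 2}

/-- The patterns that cover a codeword of type `(a, b)`. -/
def typeCovering (C : Submodule (ZMod 2) (Fin n → ZMod 2)) (i j : Fin n) (a b : ZMod 2) :
    Set (Fin n → ZMod 2) :=
  {z | (coveredBy (typeCode C i j a b) z).Nonempty}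

/-- The patterns that cover a codeword of some nonzero type. -/
def nonzeroTypeCovering (C : Submodule (ZMod 2) (Fin n → ZMod 2)) (i j : Fin n) :
    Set (Fin n → ZMod 2) :=
  typeCovering C i j 0 1 ∪ typeCovering C i j 1 0 ∪ typeCovering C i j 1 1

/-- The patterns that cover exactly one nonzero type, `B₂ ∪ B₃ ∪ B₄` in the paper. -/
abbrev uniqueTypeCovering (C : Submodule (ZMod 2) (Fin n → ZMod 2)) (i j : Fin n) :
    Set (Fin n → ZMod 2) :=
  only01 C i j ∪ only10 C i j ∪ only11 C i j

theorem mem_typeCovering_iff {a b : ZMod 2} :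
    z ∈ typeCovering C i j a b ↔ ∃ c ∈ C, c i = a ∧ c j = b ∧ ∀ k, c k = 1 → z k = 1 := by
  simp [typeCovering, Set.Nonempty, coveredBy, typeCode, and_assoc]

theorem add_covered {c c' : Fin n → ZMod 2} (hc : ∀ k, c k = 1 → z k = 1)
    (hc' : ∀ k, c' k = 1 → z k = 1) (k : Fin n) (hk : (c + c') k = 1) : z k = 1 := by
  rcases zmod_two_eq_zero_or_one (c k) with h0 | h1
  · exact hc' k (by simpa [h0] using hk)
  · exact hc k h1

theorem covered_update_zero {c : Fin n → ZMod 2} (hc : ∀ k, c k = 1 → z k = 1) {k : Fin n}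
    (hck : c k = 0) (l : Fin n) (hl : c l = 1) : Function.update z k 0 l = 1 := by
  rw [Function.update_of_ne (by rintro rfl; simp [hck] at hl)]
  exact hc l hl

theorem add_mem_typeCovering {a b a' b' : ZMod 2} (h : z ∈ typeCovering C i j a b)
    (h' : z ∈ typeCovering C i j a' b') : z ∈ typeCovering C i j (a + a') (b + b') := by
  rw [mem_typeCovering_iff] at *
  obtain ⟨c, hc, rfl, rfl, hcz⟩ := h
  obtain ⟨c', hc', rfl, rfl, hcz'⟩ := h'
  exact ⟨c + c', C.add_mem hc hc', rfl, rfl, add_covered hcz hcz'⟩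

theorem isIncreasing_typeCovering (a b : ZMod 2) : IsIncreasing (typeCovering C i j a b) :=
  fun _ ⟨c, hc, hcz⟩ _ h => ⟨c, hc, fun k hk => h k (hcz k hk)⟩

theorem isIncreasing_nonzeroTypeCovering : IsIncreasing (nonzeroTypeCovering C i j) :=
  ((isIncreasing_typeCovering 0 1).union (isIncreasing_typeCovering 1 0)).union
    (isIncreasing_typeCovering 1 1)

theorem only11_eq_sdiff :
    only11 C i j = (typeCovering C i j 1 0 ∪ typeCovering C i j 1 1) \ typeCovering C i j 1 0 := by
  ext z
  have h : z ∈ typeCovering C i j 0 1 → z ∈ typeCovering C i j 1 1 → z ∈ typeCovering C i j 1 0 :=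
    add_mem_typeCovering
  simp only [typeCovering, only11, Set.mem_sdiff, Set.mem_union, Set.mem_ofPred_eq,
    ← Set.not_nonempty_iff_eq_empty] at h ⊢
  tauto

theorem uniqueTypeCovering_eq_sdiff :
    uniqueTypeCovering C i j =
      nonzeroTypeCovering C i j \ (typeCovering C i j 0 1 ∩ typeCovering C i j 1 0) := by
  ext z
  have h11 : z ∈ typeCovering C i j 0 1 → z ∈ typeCovering C i j 1 0 →
      z ∈ typeCovering C i j 1 1 := add_mem_typeCovering
  have h10 : z ∈ typeCovering C i j 0 1 → z ∈ typeCovering C i j 1 1 →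
      z ∈ typeCovering C i j 1 0 := add_mem_typeCovering
  have h01 : z ∈ typeCovering C i j 1 0 → z ∈ typeCovering C i j 1 1 →
      z ∈ typeCovering C i j 0 1 := add_mem_typeCovering
  simp only [typeCovering, uniqueTypeCovering, nonzeroTypeCovering, only01, only10, only11,
    Set.mem_sdiff, Set.mem_union, Set.mem_inter_iff, Set.mem_ofPred_eq,
    ← Set.not_nonempty_iff_eq_empty] at h11 h10 h01 ⊢
  tauto

theorem innerBoundary_nonzeroTypeCovering_subset :
    innerBoundary (nonzeroTypeCovering C i j) ⊆ uniqueTypeCovering C i j := by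
  rintro z ⟨hz, k, hk⟩
  rw [uniqueTypeCovering_eq_sdiff]
  refine ⟨hz, fun ⟨h01, h10⟩ => hk ?_⟩
  obtain ⟨c, hc, hci, hcj, hcz⟩ := mem_typeCovering_iff.1 h01
  obtain ⟨c', hc', hci', hcj', hcz'⟩ := mem_typeCovering_iff.1 h10
  rcases zmod_two_eq_zero_or_one (c k) with hck | hck
  · exact Or.inl (Or.inl (mem_typeCovering_iff.2
      ⟨c, hc, hci, hcj, covered_update_zero hcz hck⟩))
  rcases zmod_two_eq_zero_or_one (c' k) with hck' | hck'
  · exact Or.inl (Or.inr (mem_typeCovering_iff.2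
      ⟨c', hc', hci', hcj', covered_update_zero hcz' hck'⟩))
  have hsum : (c + c') k = 0 := by simp [hck, hck', CharTwo.add_self_eq_zero]
  exact Or.inr (mem_typeCovering_iff.2 ⟨c + c', C.add_mem hc hc', by simp [hci, hci'],
    by simp [hcj, hcj'], covered_update_zero (add_covered hcz hcz') hsum⟩)

theorem half_mul_one_sub_le_sqrt_mul_prob_uniqueTypeCovering {p : Fin n → ℝ}
    (hp : ∀ k, p k ∈ Set.Icc 0 1) :
    1 / 2 * (prob (prodLaw p) (nonzeroTypeCovering C i j) *
        (1 - prob (prodLaw p) (nonzeroTypeCovering C i j))) ≤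
      √n * prob (prodLaw p) (uniqueTypeCovering C i j) :=
  (half_mul_one_sub_le_sqrt_mul_prob_innerBoundary hp isIncreasing_nonzeroTypeCovering).trans <|
    mul_le_mul_of_nonneg_left
      (prob_mono (prodLaw_nonneg hp) innerBoundary_nonzeroTypeCovering_subset) (Real.sqrt_nonneg _)

end Covering

section ErasureChannel

variable {n : ℕ}

/-- The outcomes of the experiment: a channel input together with a channel output. -/
abbrev BecOutcome (n : ℕ) : Type := (Fin n → ZMod 2) × (Fin n → Option (ZMod 2))

/-- An output is consistent with an input if its unerased symbols are those of the input. -/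
def IsConsistent (ω : BecOutcome n) : Prop :=
  ∀ k, ω.2 k = none ∨ ω.2 k = some (ω.1 k)

/-- The translation by the word `c` of both the input and the unerased outputs; for `c ∈ C` it is
a symmetry of the joint law. -/
def channelShift (c : Fin n → ZMod 2) (ω : BecOutcome n) : BecOutcome n :=
  (ω.1 + c, fun k => (ω.2 k).map (· + c k))

/-- The observations of the channel that behave linearly under translations: translating is well
defined on the observed value, and the difference of two consistent inputs with the same observed
value is invisible. -/
structure IsLinearObservation {γ : Type*} (W : BecOutcome n → γ) : Prop where
  shift_congr : ∀ c ω ω', W ω = W ω' → W (channelShift c ω) = W (channelShift c ω')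
  shift_add_eq : ∀ ω ω', IsConsistent ω → IsConsistent ω' → W ω = W ω' →
    W (channelShift (ω.1 + ω'.1) ω) = W ω

theorem channelShift_involutive (c : Fin n → ZMod 2) : Function.Involutive (channelShift c) := by
  intro ω
  ext k : 2 <;> simp [channelShift, Function.comp_def, add_assoc, CharTwo.add_self_eq_zero]

theorem bitX_channelShift (i : Fin n) (c : Fin n → ZMod 2) (ω : BecOutcome n) :
    bitX i (channelShift c ω) = bitX i ω + c i := rfl

theorem channelShift_snd_eq_iff {c : Fin n → ZMod 2} {ω : BecOutcome n} {k : Fin n} :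
    (channelShift c ω).2 k = ω.2 k ↔ ω.2 k = none ∨ c k = 0 := by
  cases h : ω.2 k <;> simp [channelShift, h]

section Law

variable {C : Submodule (ZMod 2) (Fin n → ZMod 2)} {ε : ℝ} {ω : BecOutcome n}

theorem becTransition_nonneg (hε : ε ∈ Set.Icc 0 1) (x : ZMod 2) (y : Option (ZMod 2)) :
    0 ≤ becTransition ε x y := by
  cases y
  · exact hε.1
  · simp only [becTransition]
    split_ifs
    exacts [sub_nonneg.2 hε.2, le_rfl]

theorem becTransition_shift (ε : ℝ) (x c : ZMod 2) (y : Option (ZMod 2)) :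
    becTransition ε (x + c) (y.map (· + c)) = becTransition ε x y := by
  cases y <;> simp [becTransition]

theorem becLaw_nonneg (hε : ε ∈ Set.Icc 0 1) : 0 ≤ becLaw C ε := by
  intro ω
  refine mul_nonneg ?_ (Finset.prod_nonneg fun k _ => becTransition_nonneg hε _ _)
  split_ifs <;> positivity

theorem becLaw_channelShift {c : Fin n → ZMod 2} (hc : c ∈ C) :
    becLaw C ε (channelShift c ω) = becLaw C ε ω := by
  classical
  simp [becLaw, channelShift, becTransition_shift, C.add_mem_iff_left hc]

theorem fst_mem_of_becLaw_ne_zero (h : becLaw C ε ω ≠ 0) : ω.1 ∈ C := by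
  by_contra hC
  simp [becLaw, hC] at h

theorem isConsistent_of_becLaw_ne_zero (h : becLaw C ε ω ≠ 0) : IsConsistent ω := by
  intro k
  have hk := Finset.prod_ne_zero_iff.1 (right_ne_zero_of_mul h) k (Finset.mem_univ k)
  cases hy : ω.2 k with
  | none => exact Or.inl rfl
  | some b =>
    rw [hy] at hk
    exact Or.inr (congrArg some (by_contra fun hb => hk (if_neg hb)))

end Law

namespace IsLinearObservation

variable {C : Submodule (ZMod 2) (Fin n → ZMod 2)} {ε : ℝ} {γ : Type*} {W : BecOutcome n → γ}

theorem const (w : γ) : IsLinearObservation (n := n) fun _ => w :=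
  ⟨fun _ _ _ _ => rfl, fun _ _ _ _ _ => rfl⟩

theorem output (P : Fin n → Prop) :
    IsLinearObservation fun (ω : BecOutcome n) (k : {k // P k}) => ω.2 k where
  shift_congr c ω ω' h := funext fun k => congrArg (Option.map (· + c k)) (congrFun h k)
  shift_add_eq ω ω' hω hω' h := funext fun k => channelShift_snd_eq_iff.2 <| by
    have hk : ω.2 k = ω'.2 k := congrFun h k
    rcases hω k, hω' k with ⟨h1 | h1, h2 | h2⟩
    · exact Or.inl h1
    · exact Or.inl h1
    · exact Or.inl (hk.trans h2)
    · have hfst : ω.1 k = ω'.1 k := Option.some_injective _ (h1.symm.trans (hk.trans h2))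
      exact Or.inr (by rw [Pi.add_apply, hfst, CharTwo.add_self_eq_zero])

theorem prodMk_bitX (hW : IsLinearObservation W) (j : Fin n) :
    IsLinearObservation fun ω => (bitX j ω, W ω) where
  shift_congr c ω ω' h := by
    rw [Prod.mk.injEq] at h ⊢
    exact ⟨congrArg (· + c j) h.1, hW.shift_congr c ω ω' h.2⟩
  shift_add_eq ω ω' hω hω' h := by
    rw [Prod.mk.injEq] at h ⊢
    have hj : ω.1 j = ω'.1 j := h.1
    refine ⟨?_, hW.shift_add_eq ω ω' hω hω' h.2⟩
    rw [bitX_channelShift, Pi.add_apply, hj, CharTwo.add_self_eq_zero, add_zero]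

theorem channelShift_eq_iff (hW : IsLinearObservation W) {c : Fin n → ZMod 2}
    {ω ω' : BecOutcome n} (hc : W (channelShift c ω) = W ω) :
    W (channelShift c ω') = W ω ↔ W ω' = W ω := by
  constructor <;> intro h
  · rw [← channelShift_involutive c ω', hW.shift_congr c _ _ h, hc]
  · rw [hW.shift_congr c _ _ h, hc]

theorem prob_bitX_zero_eq_prob_bitX_one (hW : IsLinearObservation W) {c : Fin n → ZMod 2}
    (hcC : c ∈ C) {i : Fin n} (hci : c i = 1) {ω : BecOutcome n}
    (hc : W (channelShift c ω) = W ω) :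
    prob (becLaw C ε) ({ω' | bitX i ω' = 0} ∩ {ω' | W ω' = W ω}) =
      prob (becLaw C ε) ({ω' | bitX i ω' = 1} ∩ {ω' | W ω' = W ω}) := by
  have hlaw : becLaw C ε ∘ channelShift c = becLaw C ε := funext fun _ => becLaw_channelShift hcC
  have hflip : ∀ b : ZMod 2, b + 1 = 0 ↔ b = 1 := by decide
  rw [← prob_preimage_of_bijective (channelShift_involutive c).bijective, hlaw]
  congr 1
  ext ω'
  simp only [Set.mem_preimage, Set.mem_inter_iff, Set.mem_ofPred_eq, bitX_channelShift, hci,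
    hW.channelShift_eq_iff hc, hflip]

theorem condEntropy_bitX [Fintype γ] (hW : IsLinearObservation W) (i : Fin n) :
    condEntropy (becLaw C ε) (bitX i) W =
      prob (becLaw C ε) {ω | ∃ c ∈ C, c i = 1 ∧ W (channelShift c ω) = W ω} := by
  set E := {ω | ∃ c ∈ C, c i = 1 ∧ W (channelShift c ω) = W ω}
  have hE : W ⁻¹' (W '' E) = E := by
    refine (Set.subset_preimage_image W E).antisymm' ?_
    rintro ω ⟨ω', ⟨c, hcC, hci, hc⟩, h⟩
    exact ⟨c, hcC, hci, by rw [← hW.shift_congr c _ _ h, hc, h]⟩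
  rw [← hE]
  refine condEntropy_eq_prob_of_fair_or_deterministic ?_ fun w hw => ?_
  · rintro _ ⟨ω, ⟨c, hcC, hci, hc⟩, rfl⟩
    exact hW.prob_bitX_zero_eq_prob_bitX_one hcC hci hc
  · by_contra! hpos
    obtain ⟨ω, ⟨hX, rfl⟩, hω⟩ := exists_ne_zero_of_prob_ne_zero (hpos 0)
    obtain ⟨ω', ⟨hX', hWω⟩, hω'⟩ := exists_ne_zero_of_prob_ne_zero (hpos 1)
    refine hw ⟨ω, ⟨ω.1 + ω'.1, C.add_mem (fst_mem_of_becLaw_ne_zero hω)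
      (fst_mem_of_becLaw_ne_zero hω'), ?_, hW.shift_add_eq ω ω'
        (isConsistent_of_becLaw_ne_zero hω) (isConsistent_of_becLaw_ne_zero hω') hWω.symm⟩, rfl⟩
    change bitX i ω + bitX i ω' = 1
    rw [hX, hX', zero_add]

end IsLinearObservation

end ErasureChannel

section ErasurePattern

variable {n : ℕ} {C : Submodule (ZMod 2) (Fin n → ZMod 2)} {ε : ℝ} {i j : Fin n}

/-- The erasure pattern of the channel output `y`, with `i` and `j` also counted as erased. -/
def erasurePattern (i j : Fin n) (y : Fin n → Option (ZMod 2)) : Fin n → ZMod 2 :=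
  fun k => if y k = none ∨ k = i ∨ k = j then 1 else 0

theorem sum_prod_becTransition_mul (ε : ℝ) (x : Fin n → ZMod 2) (u v : Fin n → ℝ) :
    ∑ y : Fin n → Option (ZMod 2),
        ∏ k, becTransition ε (x k) (y k) * (if y k = none then u k else v k) =
      ∏ k, (ε * u k + (1 - ε) * v k) := by
  rw [← Fintype.prod_sum fun k y => becTransition ε (x k) y * (if y = none then u k else v k)]
  simp [Fintype.sum_option, becTransition]

theorem sum_becLaw_mul_prod (C : Submodule (ZMod 2) (Fin n → ZMod 2)) (ε : ℝ)
    (u v : Fin n → ℝ) :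
    ∑ ω, becLaw C ε ω * ∏ k, (if ω.2 k = none then u k else v k) =
      ∏ k, (ε * u k + (1 - ε) * v k) := by
  classical
  have huniform : ∑ x : Fin n → ZMod 2, (if x ∈ C then (Nat.card C : ℝ)⁻¹ else 0) = 1 := by
    rw [← Finset.sum_filter, Finset.sum_const, nsmul_eq_mul, ← Fintype.card_subtype,
      ← Nat.card_eq_fintype_card]
    exact mul_inv_cancel₀ (Nat.cast_ne_zero.2 Nat.card_pos.ne')
  calc ∑ ω, becLaw C ε ω * ∏ k, (if ω.2 k = none then u k else v k)
      = ∑ x : Fin n → ZMod 2, (if x ∈ C then (Nat.card C : ℝ)⁻¹ else 0) *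
          ∑ y : Fin n → Option (ZMod 2),
            ∏ k, becTransition ε (x k) (y k) * (if y k = none then u k else v k) := by
        simp only [becLaw, Fintype.sum_prod_type, Finset.mul_sum, Finset.prod_mul_distrib,
          mul_assoc]
    _ = ∏ k, (ε * u k + (1 - ε) * v k) := by
        simp only [sum_prod_becTransition_mul, ← Finset.sum_mul, huniform, one_mul]

theorem sum_becLaw (C : Submodule (ZMod 2) (Fin n → ZMod 2)) (ε : ℝ) : ∑ ω, becLaw C ε ω = 1 := by
  simpa using sum_becLaw_mul_prod C ε 1 1

theorem indicator_erasurePattern_eq (i j : Fin n) (z : Fin n → ZMod 2) (ω : BecOutcome n) :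
    {ω : BecOutcome n | erasurePattern i j ω.2 = z}.indicator (1 : BecOutcome n → ℝ) ω =
      ∏ k, if ω.2 k = none then (if z k = 1 then 1 else 0)
        else if z k = (if k = i ∨ k = j then 1 else 0) then 1 else 0 := by
  have hfactor : ∀ k, (if ω.2 k = none then (if z k = 1 then (1 : ℝ) else 0)
      else if z k = (if k = i ∨ k = j then 1 else 0) then 1 else 0) =
        if erasurePattern i j ω.2 k = z k then 1 else 0 := fun k => by
    by_cases hk : ω.2 k = none <;> simp [hk, erasurePattern, eq_comm]
  simp only [hfactor, Fintype.prod_boole, ← funext_iff]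
  simp [Set.indicator_apply]

theorem prob_erasurePattern_eq (i j : Fin n) (z : Fin n → ZMod 2) :
    prob (becLaw C ε) {ω | erasurePattern i j ω.2 = z} = patternLaw ε i j z := by
  rw [prob_eq_sum_mul_indicator, patternLaw]
  simp only [indicator_erasurePattern_eq, sum_becLaw_mul_prod]
  refine Finset.prod_congr rfl fun k _ => ?_
  rcases zmod_two_eq_zero_or_one (z k) with hz | hz <;>
    by_cases hk : k = i ∨ k = j <;> simp [hz, hk]

theorem prob_erasurePattern_mem (S : Set (Fin n → ZMod 2)) :
    prob (becLaw C ε) {ω | erasurePattern i j ω.2 ∈ S} = prob (patternLaw ε i j) S := by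
  rw [← funext fun z => prob_erasurePattern_eq (C := C) (ε := ε) i j z]
  exact prob_preimage _ _ _

theorem patternLaw_eq_prodLaw (ε : ℝ) (i j : Fin n) :
    patternLaw ε i j = prodLaw fun k => if k = i ∨ k = j then 1 else ε := by
  ext z
  refine Finset.prod_congr rfl fun k _ => ?_
  by_cases hk : k = i ∨ k = j <;> simp [hk]

theorem patternLaw_nonneg (hε : ε ∈ Set.Icc 0 1) : 0 ≤ patternLaw ε i j := by
  intro z
  rw [← prob_erasurePattern_eq (C := ⊥)]
  exact prob_nonneg (becLaw_nonneg hε) _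

theorem outExceptTwo_channelShift_eq_iff {c : Fin n → ZMod 2} {ω : BecOutcome n} :
    outExceptTwo i j (channelShift c ω) = outExceptTwo i j ω ↔
      ∀ k, c k = 1 → erasurePattern i j ω.2 k = 1 := by
  simp only [funext_iff, Subtype.forall, outExceptTwo, channelShift_snd_eq_iff]
  refine forall_congr' fun k => ?_
  have hpattern : erasurePattern i j ω.2 k = 1 ↔ ω.2 k = none ∨ k = i ∨ k = j := by
    simp only [erasurePattern, ite_eq_left_iff, zero_ne_one, imp_false, not_not]
  have hc : c k = 1 ↔ c k ≠ 0 := by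
    rcases zmod_two_eq_zero_or_one (c k) with h | h <;> simp [h]
  rw [hpattern, hc]
  tauto

theorem outExceptTwo_channelShift_eq_of_outExcept {c : Fin n → ZMod 2} {ω : BecOutcome n}
    (h : outExcept i (channelShift c ω) = outExcept i ω) :
    outExceptTwo i j (channelShift c ω) = outExceptTwo i j ω :=
  funext fun k => congrFun h ⟨k, k.2.1⟩

theorem outExcept_channelShift_eq_of_outExceptTwo {c : Fin n → ZMod 2} {ω : BecOutcome n}
    (h : outExceptTwo i j (channelShift c ω) = outExceptTwo i j ω) (hcj : c j = 0) :
    outExcept i (channelShift c ω) = outExcept i ω := by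
  ext1 ⟨k, hki⟩
  by_cases hkj : k = j
  · exact channelShift_snd_eq_iff.2 (Or.inr (hkj ▸ hcj))
  · exact congrFun h ⟨k, hki, hkj⟩

end ErasurePattern

section CodeEntropy

variable {n : ℕ} {C : Submodule (ZMod 2) (Fin n → ZMod 2)} {ε : ℝ} {i j : Fin n}

theorem isLinearObservation_outExcept (i : Fin n) : IsLinearObservation (outExcept i) :=
  .output _

theorem isLinearObservation_outExceptTwo (i j : Fin n) : IsLinearObservation (outExceptTwo i j) :=
  .output _

theorem condEntropy_bitX_outExceptTwo :
    condEntropy (becLaw C ε) (bitX i) (outExceptTwo i j) =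
      prob (patternLaw ε i j) (typeCovering C i j 1 0 ∪ typeCovering C i j 1 1) := by
  rw [← prob_erasurePattern_mem (C := C), (isLinearObservation_outExceptTwo i j).condEntropy_bitX]
  congr 1
  ext ω
  simp only [Set.mem_ofPred_eq, Set.mem_union, mem_typeCovering_iff,
    ← outExceptTwo_channelShift_eq_iff]
  constructor
  · rintro ⟨c, hc, hci, hcW⟩
    exact (zmod_two_eq_zero_or_one (c j)).imp (⟨c, hc, hci, ·, hcW⟩) (⟨c, hc, hci, ·, hcW⟩)
  · rintro (⟨c, hc, hci, -, hcW⟩ | ⟨c, hc, hci, -, hcW⟩) <;> exact ⟨c, hc, hci, hcW⟩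

theorem condEntropy_bitX_bitX_outExceptTwo :
    condEntropy (becLaw C ε) (bitX i) (fun ω => (bitX j ω, outExceptTwo i j ω)) =
      prob (patternLaw ε i j) (typeCovering C i j 1 0) := by
  rw [← prob_erasurePattern_mem (C := C),
    ((isLinearObservation_outExceptTwo i j).prodMk_bitX j).condEntropy_bitX]
  simp only [mem_typeCovering_iff, ← outExceptTwo_channelShift_eq_iff, Prod.mk.injEq,
    bitX_channelShift, add_eq_left]

theorem condMutualInfo_eq_prob_only11 :
    condMutualInfo (becLaw C ε) (bitX i) (bitX j) (outExceptTwo i j) =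
      prob (patternLaw ε i j) (only11 C i j) := by
  rw [condMutualInfo, condEntropy_bitX_outExceptTwo, condEntropy_bitX_bitX_outExceptTwo,
    only11_eq_sdiff, prob_sdiff _ Set.subset_union_left]

theorem condEntropy_bitX_outExcept :
    condEntropy (becLaw C ε) (bitX i) (outExcept i) = prob (becLaw C ε)
      {ω | ∃ c ∈ C, c i = 1 ∧ outExcept i (channelShift c ω) = outExcept i ω} :=
  (isLinearObservation_outExcept i).condEntropy_bitX i

theorem condEntropy_bitX_outExcept_le (hε : ε ∈ Set.Icc 0 1) :
    condEntropy (becLaw C ε) (bitX i) (outExcept i) ≤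
      prob (patternLaw ε i j) (nonzeroTypeCovering C i j) := by
  rw [condEntropy_bitX_outExcept, ← prob_erasurePattern_mem (C := C)]
  refine prob_mono (becLaw_nonneg hε) ?_
  rintro ω ⟨c, hc, hci, hcW⟩
  have hcov := outExceptTwo_channelShift_eq_iff.1
    (outExceptTwo_channelShift_eq_of_outExcept (j := j) hcW)
  rcases zmod_two_eq_zero_or_one (c j) with hcj | hcj
  · exact Or.inl (Or.inr (mem_typeCovering_iff.2 ⟨c, hc, hci, hcj, hcov⟩))
  · exact Or.inr (mem_typeCovering_iff.2 ⟨c, hc, hci, hcj, hcov⟩)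

theorem prob_typeCovering_one_zero_le_condEntropy (hε : ε ∈ Set.Icc 0 1) :
    prob (patternLaw ε i j) (typeCovering C i j 1 0) ≤
      condEntropy (becLaw C ε) (bitX i) (outExcept i) := by
  rw [condEntropy_bitX_outExcept, ← prob_erasurePattern_mem (C := C)]
  refine prob_mono (becLaw_nonneg hε) fun ω hω => ?_
  obtain ⟨c, hc, hci, hcj, hcov⟩ := mem_typeCovering_iff.1 hω
  exact ⟨c, hc, hci, outExcept_channelShift_eq_of_outExceptTwo
    (outExceptTwo_channelShift_eq_iff.2 hcov) hcj⟩

theorem prob_nonzeroTypeCovering_le (hε : ε ∈ Set.Icc 0 1) :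
    prob (patternLaw ε i j) (nonzeroTypeCovering C i j) ≤
      prob (patternLaw ε i j) (uniqueTypeCovering C i j) +
        condEntropy (becLaw C ε) (bitX i) (outExcept i) := by
  have hsub : nonzeroTypeCovering C i j ⊆ uniqueTypeCovering C i j ∪ typeCovering C i j 1 0 := by
    rw [uniqueTypeCovering_eq_sdiff]
    intro z hz
    by_cases h10 : z ∈ typeCovering C i j 1 0
    · exact Or.inr h10
    · exact Or.inl ⟨hz, fun h => h10 h.2⟩
  calc prob (patternLaw ε i j) (nonzeroTypeCovering C i j)
      ≤ prob (patternLaw ε i j) (uniqueTypeCovering C i j ∪ typeCovering C i j 1 0) :=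
        prob_mono (patternLaw_nonneg hε) hsub
    _ ≤ prob (patternLaw ε i j) (uniqueTypeCovering C i j) +
          prob (patternLaw ε i j) (typeCovering C i j 1 0) :=
        prob_union_le (patternLaw_nonneg hε) _ _
    _ ≤ _ := by gcongr; exact prob_typeCovering_one_zero_le_condEntropy hε

open Classical in
theorem entropy_bitX : entropy (becLaw C ε) (bitX i) = if ∃ c ∈ C, c i = 1 then 1 else 0 := by
  rw [← condEntropy_const (sum_becLaw C ε), (IsLinearObservation.const ()).condEntropy_bitX]
  split_ifs with h <;> simp [h, prob_univ, prob_empty, sum_becLaw]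

theorem condEntropy_mem_Ioo_of_mutualInfo_mem_Ioo (hε : ε ∈ Set.Icc 0 1) {δ : ℝ} (hδ : 0 ≤ δ)
    (h : mutualInfo (becLaw C ε) (bitX i) (outExcept i) ∈ Set.Ioo δ (1 - δ)) :
    condEntropy (becLaw C ε) (bitX i) (outExcept i) ∈ Set.Ioo δ (1 - δ) := by
  have hpos : 0 ≤ condEntropy (becLaw C ε) (bitX i) (outExcept i) := by
    rw [condEntropy_bitX_outExcept]
    exact prob_nonneg (becLaw_nonneg hε) _
  rw [mutualInfo, entropy_bitX, Set.mem_Ioo] at h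
  split_ifs at h
  · constructor <;> linarith
  · linarith

theorem div_sqrt_le_prob_uniqueTypeCovering (hε : ε ∈ Set.Icc 0 1) {δ : ℝ} (hδ : 0 ≤ δ)
    (h : condEntropy (becLaw C ε) (bitX i) (outExcept i) ∈ Set.Ioo δ (1 - δ)) :
    δ / 8 / √n ≤ prob (patternLaw ε i j) (uniqueTypeCovering C i j) := by
  have hn : 1 ≤ √(n : ℝ) := Real.one_le_sqrt.2 (Nat.one_le_cast.2 i.pos)
  have hp : ∀ k : Fin n, (if k = i ∨ k = j then 1 else ε) ∈ Set.Icc 0 1 := fun k => by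
    split_ifs
    exacts [⟨zero_le_one, le_rfl⟩, hε]
  have hiso := half_mul_one_sub_le_sqrt_mul_prob_uniqueTypeCovering (C := C) (i := i) (j := j) hp
  rw [← patternLaw_eq_prodLaw] at hiso
  have hlower := condEntropy_bitX_outExcept_le (C := C) (i := i) (j := j) hε
  have hupper := prob_nonzeroTypeCovering_le (C := C) (i := i) (j := j) hε
  set r := prob (patternLaw ε i j) (uniqueTypeCovering C i j)
  set a := prob (patternLaw ε i j) (nonzeroTypeCovering C i j)
  rcases le_total (δ / 8) r with hr | hr
  · exact (div_le_self (by positivity) hn).trans hr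
  · have hvar : δ / 4 ≤ a * (1 - a) := by
      rcases le_total a (1 / 2) with ha | ha <;> nlinarith [h.1, h.2]
    rw [div_le_iff₀ (by positivity)]
    linarith

end CodeEntropy

theorem theorem4 :
    ∃ c : ℝ → ℝ,
      (∀ δ₀ : ℝ, 0 < δ₀ → ∃ κ : ℝ, 0 < κ ∧ ∀ δ : ℝ, δ₀ ≤ δ → δ < 1 / 2 → κ ≤ c δ) ∧
      ∀ (δ : ℝ), 0 < δ → δ < 1 / 2 →
      ∀ (n : ℕ) (C : Submodule (ZMod 2) (Fin n → ZMod 2)) (ε : ℝ), 0 ≤ ε → ε ≤ 1 →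
      ∀ (i j : Fin n), i ≠ j →
        mutualInfo (becLaw C ε) (bitX i) (outExcept i) ∈ Set.Ioo δ (1 - δ) →
          0 < prob (patternLaw ε i j) (only01 C i j ∪ only10 C i j ∪ only11 C i j) ∧
          c δ / Real.sqrt n * alphaCoeff C ε i j ≤
            condMutualInfo (becLaw C ε) (bitX i) (bitX j) (outExceptTwo i j) := by
  refine ⟨fun δ => δ / 8, fun δ₀ hδ₀ => ⟨δ₀ / 8, by positivity, fun δ hδ _ => by linarith⟩, ?_⟩
  intro δ hδ _ n C ε hε0 hε1 i j _ hI
  have hε : ε ∈ Set.Icc 0 1 := ⟨hε0, hε1⟩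
  have hr : δ / 8 / √n ≤ prob (patternLaw ε i j) (uniqueTypeCovering C i j) :=
    div_sqrt_le_prob_uniqueTypeCovering hε hδ.le
      (condEntropy_mem_Ioo_of_mutualInfo_mem_Ioo hε hδ.le hI)
  have hn : (0 : ℝ) < n := Nat.cast_pos.2 i.pos
  have hpos : 0 < prob (patternLaw ε i j) (uniqueTypeCovering C i j) :=
    lt_of_lt_of_le (by positivity) hr
  refine ⟨hpos, ?_⟩
  rw [condMutualInfo_eq_prob_only11, alphaCoeff, condProb,
    Set.inter_eq_left.2 Set.subset_union_right, mul_div_assoc', div_le_iff₀ hpos, mul_comm]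
  exact mul_le_mul_of_nonneg_left hr (prob_nonneg (patternLaw_nonneg hε) _)
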